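/- Let $F/\mathbb{F}_q$ be an elliptic function field, i.e. an algebraic function field of one variable with full constant field $\mathbb{F}_q$, of genus $1$, having a place of degree one (equivalently, the function field of an elliptic curve over the finite field $\mathbb{F}_q$). Let $n,k$ be integers with $2\le k\le n-1$, let $P_1,\dots,P_n,P_\infty$ be pairwise distinct places of degree one of $F$, and put $D=P_1+\cdots+P_n$. For $m\ge 0$ let $\mathcal{L}(mP_\infty)$ be the Riemann–Roch space of the divisor $mP_\infty$ and let $$C_L(D,mP_\infty)=\{(f(P_1),\dots,f(P_n)) : f\in\mathcal{L}(mP_\infty)\}\subseteq\mathbb{F}_q^n .$$ Let $f_1,\dots,f_k$ be any basis of $\mathcal{L}(kP_\infty)$ (by the Riemann–Roch theorem, $\dim\mathcal{L}(kP_\infty)=k$), and let the extended code $C_{ex}=C_{ex}(D,kP_\infty)\subseteq\mathbb{F}_q^{n+1}$ be the linear span of the vectors $(f_j(P_1),\dots,f_j(P_n),0)$ for $1\le j\le k-1$ and $(f_k(P_1),\dots,f_k(P_n),1)$. The covering radius $\rho(C)$ of a linear code $C$ is the least integer $\rho$ such that every vector of the ambient space has Hamming distance at most $\rho$ from some codeword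 of $C$; a linear code of length $N$, dimension $K$ and minimum distance $d$ is MDS if $d+K=N+1$. If $C_L(D,(k+1)P_\infty)$ is an MDS code, then $\rho(C_{ex})\in\{n-k,\;n-k+1\}$. -/

import Mathlib

noncomputable section

namespace AGCode

/-! ### Linear codes -/

section Codes

variable {K : Type*} [Field K] [DecidableEq K] {n : ℕ}

/-- The minimum distance of a linear code: the least Hamming weight of a nonzero codeword. -/
def minDist (C : Submodule K (Fin n → K)) : ℕ :=
  sInf {w : ℕ | ∃ c ∈ C, c ≠ 0 ∧ hammingNorm c = w}

/-- A linear code is MDS if it attains the Singleton bound `d + k ≤ n + 1`. -/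
def IsMDS (C : Submodule K (Fin n → K)) : Prop :=
  minDist C + Module.finrank K C = n + 1

/-- The covering radius: the least `ρ` such that every vector has Hamming distance at most `ρ`
from some codeword. -/
def coveringRadius (C : Submodule K (Fin n → K)) : ℕ :=
  sInf {ρ : ℕ | ∀ v : Fin n → K, ∃ c ∈ C, hammingDist v c ≤ ρ}

end Codes

/-! ### Function fields, places and divisors -/

section Places

variable (K F : Type*) [Field K] [Field F] [Algebra K F]

/-- `F` is an algebraic function field of one variable over `K` with full constant field `K`:
a finite extension of `K(x)` for some `x` transcendental over `K`, in which every element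
algebraic over `K` is a constant.  For `K` finite (perfect) these are exactly the function fields
of absolutely irreducible smooth projective curves over `K`. -/
structure IsAlgFunctionField : Prop where
  exists_transcendental : ∃ x : F, Transcendental K x ∧
    FiniteDimensional (IntermediateField.adjoin K {x}) F
  full_constant_field : ∀ y : F, IsAlgebraic K y → ∃ c : K, algebraMap K F c = y

/-- A place of `F / K`, given by its valuation ring: a discrete valuation ring containing `K`
with field of fractions `F`. -/
@[ext]
structure Place where
  ring : Subalgebra K F
  isDVR : IsDiscreteValuationRing ring
  isFractionRing : IsFractionRing ring F

attribute [instance] Place.isDVR Place.isFractionRing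

variable {K F}

namespace Place

variable (P : Place K F)

/-- The normalized valuation of a place, written multiplicatively:
`P.val f = WithZero.exp (-v_P(f))` for `f ≠ 0`, and `P.val 0 = 0`. -/
def val : Valuation F (WithZero (Multiplicative ℤ)) :=
  (IsDiscreteValuationRing.maximalIdeal P.ring).valuation F

/-- The degree of a place: the degree over `K` of its residue field. -/
def degree : ℕ := Module.finrank K (IsLocalRing.ResidueField P.ring)

theorem val_le_one_iff (f : F) : P.val f ≤ 1 ↔ f ∈ P.ring := by
  constructor
  · intro h
    obtain ⟨a, ha⟩ := IsDiscreteValuationRing.exists_lift_of_le_one h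
    rw [← ha]
    exact a.2
  · intro h
    exact IsDedekindDomain.HeightOneSpectrum.valuation_le_one
      (IsDiscreteValuationRing.maximalIdeal P.ring) (⟨f, h⟩ : P.ring)

theorem val_algebraMap_le_one (c : K) : P.val (algebraMap K F c) ≤ 1 :=
  (P.val_le_one_iff _).2 (P.ring.algebraMap_mem c)

end Place

variable (K F)

/-- A rational place: a place of degree one. -/
@[ext]
structure RationalPlace extends Place K F where
  degree_eq_one : toPlace.degree = 1

/-- Divisors: formal finite integer combinations of places. -/
abbrev Divisor := Place K F →₀ ℤ

variable {K F}

/-- The value `f(P)` in `K` of `f` in the valuation ring of a rational place `P`: the residue class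
of `f`, under the identification of `K` with the residue field of `P`. -/
def RationalPlace.eval (P : RationalPlace K F) : P.ring →ₐ[K] K :=
  (AlgEquiv.ofBijective (Algebra.ofId K (IsLocalRing.ResidueField P.ring))
      (Algebra.finrank_eq_one_iff_bijective_algebraMap.mp P.degree_eq_one)).symm.toAlgHom.comp
    (IsScalarTower.toAlgHom K P.ring (IsLocalRing.ResidueField P.ring))

/-- The degree of a divisor. -/
def Divisor.deg (A : Divisor K F) : ℤ := A.sum fun P a => a * (P.degree : ℤ)

/-- The Riemann-Roch space `L(A)`: all `f` with `f = 0` or `v_P(f) ≥ -A(P)` for every place `P`. -/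
def riemannRoch (A : Divisor K F) : Submodule K F where
  carrier := {f | ∀ P : Place K F, P.val f ≤ WithZero.exp (A P)}
  add_mem' := fun {f g} hf hg P => (P.val.map_add f g).trans (max_le (hf P) (hg P))
  zero_mem' := fun P => by simp
  smul_mem' := fun c f hf P => by
    rw [Algebra.smul_def, map_mul]
    calc P.val (algebraMap K F c) * P.val f ≤ 1 * WithZero.exp (A P) :=
          mul_le_mul' (P.val_algebraMap_le_one c) (hf P)
      _ = WithZero.exp (A P) := one_mul _

variable (K F) in
/-- `F / K` has genus `g`, where the genus is `max (deg A - ℓ(A) + 1)` over all divisors `A`. -/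
def HasGenus (g : ℕ) : Prop :=
  IsGreatest (Set.range fun A : Divisor K F => A.deg - Module.finrank K (riemannRoch A) + 1) (g : ℤ)

/-- The divisor `m P`. -/
def multiple (m : ℕ) (P : Place K F) : Divisor K F := Finsupp.single P (m : ℤ)

theorem mem_ring_of_mem_riemannRoch {A : Divisor K F} {P : Place K F} (hA : A P = 0) {f : F}
    (hf : f ∈ riemannRoch A) : f ∈ P.ring := by
  have h := hf P
  rw [hA, WithZero.exp_zero] at h
  exact (P.val_le_one_iff f).1 h

/-! ### Algebraic geometry codes -/

variable {n : ℕ}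

/-- The evaluation map `f ↦ (f(P₁), …, f(Pₙ))` on `L(G)`, where no `P i` is in the support
of `G`. -/
def evalMap (P : Fin n → RationalPlace K F) (G : Divisor K F) (hG : ∀ i, G (P i).toPlace = 0) :
    riemannRoch G →ₗ[K] (Fin n → K) :=
  LinearMap.pi fun i =>
    (P i).eval.toLinearMap.comp
      (LinearMap.codRestrict (Subalgebra.toSubmodule (P i).ring) (riemannRoch G).subtype
        fun f => mem_ring_of_mem_riemannRoch (hG i) f.2)

theorem multiple_apply_eq_zero (m : ℕ) {P : Fin n → RationalPlace K F} {Q : RationalPlace K F}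
    (hQ : ∀ i, P i ≠ Q) (i : Fin n) : multiple m Q.toPlace (P i).toPlace = 0 :=
  Finsupp.single_eq_of_ne fun h => hQ i (RationalPlace.ext (congrArg Place.ring h))

/-- The code `C_L(D, mQ)` with `D = P₁ + ⋯ + Pₙ`. -/
def codeL (P : Fin n → RationalPlace K F) (Q : RationalPlace K F) (hQ : ∀ i, P i ≠ Q) (m : ℕ) :
    Submodule K (Fin n → K) :=
  LinearMap.range (evalMap P (multiple m Q.toPlace) (multiple_apply_eq_zero m hQ))

/-- The generator matrix `(G | ∞ᵀ)` attached to an ordered basis `f` of `L(mQ)`: the `i`-th row is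
`(fᵢ(P₁), …, fᵢ(Pₙ), 0)`, except that the last row ends in `1`. The basis is indexed by
`Fin (r + 1)` because `L(mQ)` is nonzero. -/
def extMatrix (P : Fin n → RationalPlace K F) (Q : RationalPlace K F) (hQ : ∀ i, P i ≠ Q) (m : ℕ)
    {r : ℕ} (f : Module.Basis (Fin (r + 1)) K (riemannRoch (multiple m Q.toPlace))) :
    Matrix (Fin (r + 1)) (Fin (n + 1)) K :=
  Matrix.of fun i => Fin.snoc
    (evalMap P (multiple m Q.toPlace) (multiple_apply_eq_zero m hQ) (f i))
    (if i = Fin.last r then 1 else 0)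

/-- The extended code `C_ex(D, mQ)`: the row space of `(G | ∞ᵀ)`. -/
def codeEx (P : Fin n → RationalPlace K F) (Q : RationalPlace K F) (hQ : ∀ i, P i ≠ Q) (m : ℕ)
    {r : ℕ} (f : Module.Basis (Fin (r + 1)) K (riemannRoch (multiple m Q.toPlace))) :
    Submodule K (Fin (n + 1) → K) :=
  Submodule.span K (Set.range (extMatrix P Q hQ m f).row)

end Places

end AGCode

end

/-! `C_ex` has length `n + 1` and dimension `k`, so its redundancy `n + 1 - k` bounds the covering
radius from above (`coveringRadius_le`). For the lower bound, take `h` in `L((k+1)P_∞)` outside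
`L(kP_∞)`. Deleting the last coordinate sends `C_ex` into `C_L(D, kP_∞)`, so the evaluation of `h`
minus a punctured codeword is a nonzero word of the MDS code `C_L(D, (k+1)P_∞)`, hence has weight at
least `n - k` (`HasGenus.le_coveringRadius_codeEx`).

The input from function fields is `dim L(mP_∞) = m` and `L(A) = 0` for `deg A < 0`. Both are derived
from the genus as a maximum: `deg A ≤ dim L(A)` always, with equality for some `A`. A nonconstant
function in `L(P_∞)` would make every degree-zero divisor principal and rule out equality
(`HasGenus.riemannRoch_single_le`). -/

noncomputable section

namespace AGCode

open Module

/-! ### Riemann–Roch spaces and degrees of divisors. -/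

section RiemannRoch

variable {K F : Type*} [Field K] [Field F] [Algebra K F]

open WithZero in
theorem Place.val_le_exp_sub_one (P : Place K F) {f : F} {a : ℤ} (h : P.val f < exp a) :
    P.val f ≤ exp (a - 1) := by
  by_cases h0 : P.val f = 0
  · simp [h0]
  · rw [← log_le_iff_le_exp h0]
    rw [← log_lt_iff_lt_exp h0] at h
    omega

theorem mem_riemannRoch {A : Divisor K F} {f : F} :
    f ∈ riemannRoch A ↔ ∀ P : Place K F, P.val f ≤ WithZero.exp (A P) := Iff.rfl

theorem riemannRoch_mono {A B : Divisor K F} (h : A ≤ B) : riemannRoch A ≤ riemannRoch B :=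
  fun _ hf P => (hf P).trans (WithZero.exp_le_exp.2 (h P))

theorem sub_single_le (A : Divisor K F) (P : Place K F) : A - Finsupp.single P 1 ≤ A :=
  sub_le_self _ (Finsupp.single_nonneg.2 zero_le_one)

theorem mem_riemannRoch_sub_single {A : Divisor K F} {f : F} (hf : f ∈ riemannRoch A)
    {P : Place K F} (h : P.val f < WithZero.exp (A P)) :
    f ∈ riemannRoch (A - Finsupp.single P 1) := by
  intro R
  by_cases hR : R = P
  · subst hR
    simpa using R.val_le_exp_sub_one h
  · simpa [Finsupp.single_eq_of_ne hR] using hf R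

theorem val_eq_of_notMem {A : Divisor K F} {f : F} (hf : f ∈ riemannRoch A)
    {P : Place K F} (h : f ∉ riemannRoch (A - Finsupp.single P 1)) :
    P.val f = WithZero.exp (A P) :=
  (hf P).eq_of_not_lt fun hlt => h (mem_riemannRoch_sub_single hf hlt)

theorem notMem_riemannRoch_sub_single {A : Divisor K F} {f : F} {P : Place K F}
    (h : P.val f = WithZero.exp (A P)) : f ∉ riemannRoch (A - Finsupp.single P 1) := by
  intro hf
  have := hf P
  rw [h, WithZero.exp_le_exp] at this
  simp at this

theorem mul_mem_riemannRoch {A B : Divisor K F} {f g : F} (hf : f ∈ riemannRoch A)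
    (hg : g ∈ riemannRoch B) : f * g ∈ riemannRoch (A + B) := by
  intro P
  rw [map_mul, Finsupp.add_apply, WithZero.exp_add]
  exact mul_le_mul' (hf P) (hg P)

theorem inv_mem_riemannRoch {A : Divisor K F} {f : F}
    (hf : ∀ P : Place K F, P.val f = WithZero.exp (A P)) : f⁻¹ ∈ riemannRoch (-A) := by
  intro P
  rw [map_inv₀, hf P, Finsupp.neg_apply, WithZero.exp_neg]

theorem algebraMap_mem_riemannRoch_zero (c : K) :
    algebraMap K F c ∈ riemannRoch (0 : Divisor K F) := fun P => by
  simpa using P.val_algebraMap_le_one c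

/-- Multiplication by `z ∈ L(A)` as a map `L(B) → L(C)`, where `C = A + B`. -/
def mulMap {A B C : Divisor K F} (h : A + B = C) (z : F) (hz : z ∈ riemannRoch A) :
    riemannRoch B →ₗ[K] riemannRoch C :=
  (LinearMap.mulLeft K z).restrict fun _ hg => h ▸ mul_mem_riemannRoch hz hg

theorem mulMap_injective {A B C : Divisor K F} (h : A + B = C) {z : F} (hz : z ∈ riemannRoch A)
    (h0 : z ≠ 0) : Function.Injective (mulMap h z hz) := by
  intro f g hfg
  have : z * f.1 = z * g.1 := congrArg Subtype.val hfg
  exact Subtype.ext (mul_left_cancel₀ h0 this)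

theorem Divisor.deg_add (A B : Divisor K F) : (A + B).deg = A.deg + B.deg :=
  Finsupp.sum_add_index' (by simp) (by intros; ring)

theorem Divisor.deg_single (P : Place K F) (a : ℤ) :
    Divisor.deg (Finsupp.single P a) = a * P.degree :=
  Finsupp.sum_single_index (by simp)

theorem Divisor.deg_zero : Divisor.deg (0 : Divisor K F) = 0 := Finsupp.sum_zero_index

theorem Divisor.deg_neg (A : Divisor K F) : Divisor.deg (-A) = -A.deg := by
  have := Divisor.deg_add A (-A)
  rw [add_neg_cancel, Divisor.deg_zero] at this
  omega

theorem Divisor.deg_sub (A B : Divisor K F) : Divisor.deg (A - B) = A.deg - B.deg := by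
  rw [sub_eq_add_neg, Divisor.deg_add, Divisor.deg_neg, sub_eq_add_neg]

theorem deg_multiple (m : ℕ) (Q : RationalPlace K F) : (multiple m Q.toPlace).deg = m := by
  rw [multiple, Divisor.deg_single, Q.degree_eq_one]
  simp

theorem RationalPlace.deg_single (Q : RationalPlace K F) (a : ℤ) :
    Divisor.deg (Finsupp.single Q.toPlace a) = a := by
  rw [Divisor.deg_single, Q.degree_eq_one]
  simp

theorem multiple_zero (P : Place K F) : multiple 0 P = 0 := by
  simp [multiple]

theorem multiple_succ (m : ℕ) (P : Place K F) :
    multiple (m + 1) P = multiple m P + Finsupp.single P 1 := by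
  rw [multiple, multiple, ← Finsupp.single_add]
  simp

/-! ### Rational places -/

theorem RationalPlace.eval_eq_zero_iff (Q : RationalPlace K F) (f : Q.ring) :
    Q.eval f = 0 ↔ Q.val (f : F) < 1 := by
  have h1 : Q.val (f : F) < 1 ↔ f ∈ IsLocalRing.maximalIdeal Q.ring :=
    IsDedekindDomain.HeightOneSpectrum.valuation_lt_one_iff_mem
      (IsDiscreteValuationRing.maximalIdeal Q.ring) f
  rw [h1, ← IsLocalRing.residue_eq_zero_iff]
  exact EmbeddingLike.map_eq_zero_iff (f := (AlgEquiv.ofBijective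
    (Algebra.ofId K (IsLocalRing.ResidueField Q.ring))
      (Algebra.finrank_eq_one_iff_bijective_algebraMap.mp Q.degree_eq_one)).symm)

theorem RationalPlace.exists_val_sub_lt_one (Q : RationalPlace K F) {f : F} (hf : Q.val f ≤ 1) :
    ∃ c : K, Q.val (f - algebraMap K F c) < 1 := by
  set g : Q.ring := ⟨f, (Q.val_le_one_iff f).1 hf⟩ with hg
  refine ⟨Q.eval g, ?_⟩
  have := (Q.eval_eq_zero_iff (g - algebraMap K Q.ring (Q.eval g))).1 (by
    rw [map_sub, AlgHom.commutes]; simp)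
  exact this

/-- Cancellation of leading terms: `f / g` is regular at `Q`, and its residue is a constant because
`Q` has degree one. -/
theorem RationalPlace.exists_sub_smul_mem (Q : RationalPlace K F) {A : Divisor K F} {f g : F}
    (hf : f ∈ riemannRoch A) (hg : g ∈ riemannRoch A)
    (hg' : g ∉ riemannRoch (A - Finsupp.single Q.toPlace 1)) :
    ∃ c : K, f - c • g ∈ riemannRoch (A - Finsupp.single Q.toPlace 1) := by
  have hgv := val_eq_of_notMem hg hg'
  have hg0 : g ≠ 0 := by
    rintro rfl
    exact hg' (zero_mem _)
  have hpos : (0 : WithZero (Multiplicative ℤ)) < WithZero.exp (A Q.toPlace) := WithZero.exp_pos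
  have hle : Q.val (f / g) ≤ 1 := by
    rw [map_div₀, hgv]
    exact div_le_one_of_le₀ (hf _) zero_le
  obtain ⟨c, hc⟩ := Q.exists_val_sub_lt_one hle
  refine ⟨c, mem_riemannRoch_sub_single (sub_mem hf (Submodule.smul_mem _ c hg)) ?_⟩
  have : f - c • g = (f / g - algebraMap K F c) * g := by
    rw [Algebra.smul_def]; field_simp
  rw [this, map_mul, hgv]
  exact mul_lt_of_lt_one_left hpos hc

theorem RationalPlace.finrank_riemannRoch_le (Q : RationalPlace K F) (A : Divisor K F)
    [FiniteDimensional K (riemannRoch (A - Finsupp.single Q.toPlace 1))] :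
    finrank K (riemannRoch A) ≤ finrank K (riemannRoch (A - Finsupp.single Q.toPlace 1)) + 1 := by
  by_cases h : ∃ g ∈ riemannRoch A, g ∉ riemannRoch (A - Finsupp.single Q.toPlace 1)
  · obtain ⟨g, hg, hg'⟩ := h
    have hle : riemannRoch A ≤
        riemannRoch (A - Finsupp.single Q.toPlace 1) ⊔ Submodule.span K {g} := by
      intro f hf
      obtain ⟨c, hc⟩ := Q.exists_sub_smul_mem hf hg hg'
      exact Submodule.mem_sup.2 ⟨_, hc, c • g,
        Submodule.smul_mem _ _ (Submodule.mem_span_singleton_self g), sub_add_cancel _ _⟩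
    calc _ ≤ _ := Submodule.finrank_mono hle
      _ ≤ _ := Submodule.finrank_add_le_finrank_add_finrank _ _
      _ ≤ _ := Nat.add_le_add_left (by simpa using finrank_span_le_card (R := K) ({g} : Set F)) _
  · push Not at h
    have hle : riemannRoch A ≤ riemannRoch (A - Finsupp.single Q.toPlace 1) := h
    exact (Submodule.finrank_mono hle).trans (Nat.le_succ _)

end RiemannRoch

/-! ### Dimensions of Riemann–Roch spaces in genus one. -/

section GenusOne

variable {K F : Type*} [Field K] [Field F] [Algebra K F]

theorem HasGenus.deg_le_finrank (hg : HasGenus K F 1) (A : Divisor K F) :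
    A.deg ≤ finrank K (riemannRoch A) := by
  have := hg.2 ⟨A, rfl⟩
  push_cast at this
  omega

theorem HasGenus.exists_deg_eq_finrank (hg : HasGenus K F 1) :
    ∃ A : Divisor K F, A.deg = finrank K (riemannRoch A) := by
  obtain ⟨A, hA⟩ := hg.1
  refine ⟨A, ?_⟩
  dsimp only at hA
  push_cast at hA
  omega

theorem HasGenus.exists_mem_ne_zero (hg : HasGenus K F 1) {A : Divisor K F} (hA : 0 < A.deg) :
    ∃ z ∈ riemannRoch A, z ≠ 0 := by
  have h : 0 < finrank K (riemannRoch A) := by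
    have := hg.deg_le_finrank A
    omega
  have : riemannRoch A ≠ ⊥ := by
    intro hb
    rw [hb, finrank_bot] at h
    exact h.false
  exact Submodule.exists_mem_ne_zero_of_ne_bot this

/-- `finrank` is `0` on infinite-dimensional spaces, so a positive lower bound for it forces
finiteness. -/
theorem HasGenus.finite_riemannRoch_of_deg_pos (hg : HasGenus K F 1) {A : Divisor K F}
    (hA : 0 < A.deg) : FiniteDimensional K (riemannRoch A) := by
  refine FiniteDimensional.of_finrank_pos ?_
  have := hg.deg_le_finrank A
  omega

theorem HasGenus.finite_riemannRoch (hg : HasGenus K F 1) (Q : RationalPlace K F)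
    (A : Divisor K F) : FiniteDimensional K (riemannRoch A) := by
  -- This makes both `mQ` and `mQ - A` of positive degree; a nonzero element of `L(mQ - A)` then
  -- embeds `L(A)` into `L(mQ)`.
  set m : ℕ := A.deg.toNat + 1
  have hm : (multiple m Q.toPlace).deg = m := deg_multiple m Q
  obtain ⟨z, hz, hz0⟩ := hg.exists_mem_ne_zero (A := multiple m Q.toPlace - A) (by
    rw [Divisor.deg_sub, hm]; omega)
  have := hg.finite_riemannRoch_of_deg_pos (A := multiple m Q.toPlace) (by rw [hm]; omega)
  exact Module.Finite.of_injective (mulMap (sub_add_cancel _ A) z hz) (mulMap_injective _ hz hz0)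

/-- `L(0)` is a finite-dimensional `K`-algebra, so its elements are algebraic over `K`, hence
constant. -/
theorem riemannRoch_zero_eq (hF : IsAlgFunctionField K F)
    [FiniteDimensional K (riemannRoch (0 : Divisor K F))] :
    riemannRoch (0 : Divisor K F) = Submodule.span K {1} := by
  let S : Subalgebra K F := (riemannRoch (0 : Divisor K F)).toSubalgebra
    (by simpa using algebraMap_mem_riemannRoch_zero (F := F) (1 : K))
    fun f g hf hg => by simpa using mul_mem_riemannRoch hf hg
  have hS : FiniteDimensional K S := ‹FiniteDimensional K (riemannRoch (0 : Divisor K F))›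
  refine le_antisymm (fun f hf => ?_) ?_
  · have halg : IsAlgebraic K (⟨f, hf⟩ : S) := Algebra.IsAlgebraic.isAlgebraic _
    obtain ⟨c, hc⟩ := hF.full_constant_field f (halg.algHom S.val)
    rw [Submodule.mem_span_singleton]
    exact ⟨c, by rw [← hc, Algebra.smul_def, mul_one]⟩
  · rw [Submodule.span_singleton_le_iff_mem]
    simpa using algebraMap_mem_riemannRoch_zero (F := F) (1 : K)

theorem HasGenus.finrank_riemannRoch_zero_le (hg : HasGenus K F 1) (hF : IsAlgFunctionField K F)
    (Q : RationalPlace K F) : finrank K (riemannRoch (0 : Divisor K F)) ≤ 1 := by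
  have := hg.finite_riemannRoch Q 0
  rw [riemannRoch_zero_eq hF]
  simpa using finrank_span_le_card (R := K) ({1} : Set F)

/-- If `deg A < 0`, multiplication by `z²` embeds `L(-2A)`, of dimension at least `2`, into `L(0)`,
of dimension at most `1`. Using `z` itself would only give dimension at least `1`. -/
theorem HasGenus.deg_nonneg (hg : HasGenus K F 1) (hF : IsAlgFunctionField K F)
    (Q : RationalPlace K F) {A : Divisor K F} {z : F} (hz : z ∈ riemannRoch A) (h0 : z ≠ 0) :
    0 ≤ A.deg := by
  by_contra! hA
  have := hg.finite_riemannRoch Q 0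
  have hle := LinearMap.finrank_le_finrank_of_injective
    (mulMap_injective (add_neg_cancel (A + A)) (mul_mem_riemannRoch hz hz) (mul_ne_zero h0 h0))
  have h1 := hg.finrank_riemannRoch_zero_le hF Q
  have h2 := hg.deg_le_finrank (-(A + A))
  rw [Divisor.deg_neg, Divisor.deg_add] at h2
  omega

theorem HasGenus.riemannRoch_eq_bot (hg : HasGenus K F 1) (hF : IsAlgFunctionField K F)
    (Q : RationalPlace K F) {A : Divisor K F} (hA : A.deg < 0) : riemannRoch A = ⊥ := by
  rw [Submodule.eq_bot_iff]
  intro z hz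
  by_contra h0
  exact hA.not_ge (hg.deg_nonneg hF Q hz h0)

/-- An infinite residue degree would be recorded as `0`. Then every `Q - tP` would have degree `1`,
and the decreasing nonzero spaces `L(Q - tP)` would stabilize, yielding a nonzero function vanishing
at `P` to every order. -/
theorem HasGenus.degree_pos (hg : HasGenus K F 1) (Q : RationalPlace K F) (P : Place K F) :
    0 < P.degree := by
  by_contra! hP
  have hP0 : P.degree = 0 := by omega
  set B : ℕ → Divisor K F := fun t => multiple 1 Q.toPlace - Finsupp.single P (t : ℤ) with hB
  have hdeg : ∀ t, (B t).deg = 1 := fun t => by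
    rw [hB, Divisor.deg_sub, deg_multiple, Divisor.deg_single, hP0]
    simp
  have hanti : Antitone B := fun s t hst =>
    sub_le_sub_left (Finsupp.single_le_single.2 (by exact_mod_cast hst)) _
  have hfin := hg.finite_riemannRoch_of_deg_pos (A := B 0) (by rw [hdeg]; exact one_pos)
  let f : ℕ →o (Submodule K (riemannRoch (B 0)))ᵒᵈ :=
    ⟨fun t => OrderDual.toDual ((riemannRoch (B t)).comap (riemannRoch (B 0)).subtype),
      fun s t hst => Submodule.comap_mono (riemannRoch_mono (hanti hst))⟩
  obtain ⟨N, hN⟩ := IsArtinian.monotone_stabilizes f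
  obtain ⟨z, hz, hz0⟩ := hg.exists_mem_ne_zero (A := B N) (by rw [hdeg]; exact one_pos)
  have hz' : ∀ t, N ≤ t → z ∈ riemannRoch (B t) := fun t ht => by
    have h1 : (⟨z, riemannRoch_mono (hanti (Nat.zero_le N)) hz⟩ : riemannRoch (B 0)) ∈
        OrderDual.ofDual (f N) := hz
    rw [hN t ht] at h1
    exact h1
  have hv0 : P.val z ≠ 0 := (Valuation.ne_zero_iff _).2 hz0
  set a := WithZero.log (P.val z)
  set b := multiple 1 Q.toPlace P
  have := hz' (max N (b - a + 1).toNat) (le_max_left _ _) P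
  rw [← WithZero.log_le_iff_le_exp hv0, hB, Finsupp.sub_apply, Finsupp.single_eq_same] at this
  have h3 : (b - a + 1 : ℤ) ≤ (max N (b - a + 1).toNat : ℕ) := by
    have := le_max_right N (b - a + 1).toNat
    omega
  change a ≤ b - _ at this
  omega

/-- A nonzero element of `L(A)`, where `deg A = 0`, has divisor `-A`. -/
theorem HasGenus.val_eq_of_deg_eq_zero (hg : HasGenus K F 1) (hF : IsAlgFunctionField K F)
    (Q : RationalPlace K F) {A : Divisor K F} (hA : A.deg = 0) {z : F} (hz : z ∈ riemannRoch A)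
    (h0 : z ≠ 0) (P : Place K F) : P.val z = WithZero.exp (A P) := by
  refine val_eq_of_notMem hz fun h => ?_
  have h1 := hg.deg_nonneg hF Q h h0
  have h2 := hg.degree_pos Q P
  rw [Divisor.deg_sub, Divisor.deg_single] at h1
  omega

/-- If `L(Q)` contains a nonconstant function, then every divisor of degree zero is principal. -/
theorem HasGenus.exists_ne_zero_of_deg_eq_zero (hg : HasGenus K F 1)
    (hF : IsAlgFunctionField K F) (Q : RationalPlace K F) {f : F}
    (hf : f ∈ riemannRoch (Finsupp.single Q.toPlace 1))
    (hf' : f ∉ riemannRoch (0 : Divisor K F)) {A : Divisor K F} (hA : A.deg = 0) :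
    ∃ w ∈ riemannRoch A, w ≠ 0 := by
  by_contra! hbot
  have hAQ : (A + Finsupp.single Q.toPlace 1).deg = 1 := by
    rw [Divisor.deg_add, hA, Q.deg_single]; rfl
  obtain ⟨z, hz, hz0⟩ := hg.exists_mem_ne_zero (A := A + Finsupp.single Q.toPlace 1) (by omega)
  obtain ⟨R, hR⟩ : ∃ R : Place K F,
      z ∈ riemannRoch (A + Finsupp.single Q.toPlace 1 - Finsupp.single R 1) := by
    by_contra! h
    -- Without such an `R`, `z` would have divisor exactly `-(A + Q)`, and `z⁻¹` would lie in a
    -- space of degree `-1`.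
    have := hg.deg_nonneg hF Q (inv_mem_riemannRoch fun R => val_eq_of_notMem hz (h R))
      (inv_ne_zero hz0)
    rw [Divisor.deg_neg] at this
    omega
  have hRdeg : R.degree = 1 := by
    have h1 := hg.deg_nonneg hF Q hR hz0
    have h2 := hg.degree_pos Q R
    rw [Divisor.deg_sub, Divisor.deg_single] at h1
    omega
  have hRQ : R ≠ Q.toPlace := by
    rintro rfl
    rw [add_sub_cancel_right] at hR
    exact hz0 (hbot z hR)
  -- With `c = f(R)`, the function `f - c` has divisor `R - Q`, so `z / (f - c)` lies in `L(A)`.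
  obtain ⟨c, hc⟩ := RationalPlace.exists_val_sub_lt_one ⟨R, hRdeg⟩ (f := f) (by
    simpa [Finsupp.single_eq_of_ne hRQ] using hf R)
  have hc' : f - algebraMap K F c ∈
      riemannRoch (Finsupp.single Q.toPlace 1 - Finsupp.single R 1) := by
    refine mem_riemannRoch_sub_single (sub_mem hf ?_) ?_
    · exact riemannRoch_mono (Finsupp.single_nonneg.2 zero_le_one)
        (algebraMap_mem_riemannRoch_zero c)
    · simpa [Finsupp.single_eq_of_ne hRQ] using hc
  have hne : f - algebraMap K F c ≠ 0 := fun h => hf' (by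
    rw [sub_eq_zero.1 h]; exact algebraMap_mem_riemannRoch_zero c)
  have hinv := inv_mem_riemannRoch (hg.val_eq_of_deg_eq_zero hF Q (by
    rw [Divisor.deg_sub, Divisor.deg_single, Divisor.deg_single, hRdeg, Q.degree_eq_one]
    simp) hc' hne)
  have hprod := mul_mem_riemannRoch hR hinv
  rw [show A + Finsupp.single Q.toPlace 1 - Finsupp.single R 1 +
    -(Finsupp.single Q.toPlace 1 - Finsupp.single R 1) = A by abel] at hprod
  exact mul_ne_zero hz0 (inv_ne_zero hne) (hbot _ hprod)

theorem HasGenus.riemannRoch_single_le (hg : HasGenus K F 1) (hF : IsAlgFunctionField K F)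
    (Q : RationalPlace K F) :
    riemannRoch (Finsupp.single Q.toPlace 1) ≤ riemannRoch (0 : Divisor K F) := by
  by_contra hle
  obtain ⟨f, hf, hf'⟩ := SetLike.not_le_iff_exists.1 hle
  obtain ⟨A, hA⟩ := hg.exists_deg_eq_finrank
  set d := finrank K (riemannRoch A) with hd
  set B : Divisor K F := A - multiple d Q.toPlace with hBdef
  have hB : B.deg = 0 := by rw [Divisor.deg_sub, deg_multiple, hA, sub_self]
  obtain ⟨w, hw, hw0⟩ := hg.exists_ne_zero_of_deg_eq_zero hF Q hf hf' hB
  have hfv : Q.val f = WithZero.exp 1 := by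
    simpa using val_eq_of_notMem (P := Q.toPlace) hf (by rwa [sub_self])
  have hwv := hg.val_eq_of_deg_eq_zero hF Q hB hw hw0 Q.toPlace
  -- `w * f ^ i` attains the bound at `Q` exactly, so each step enlarges the space. At `i = d` the
  -- divisor is `A`, and its dimension `d` would be at least `d + 1`.
  have key : ∀ i : ℕ, w * f ^ i ∈ riemannRoch (B + multiple i Q.toPlace) ∧
      Q.val (w * f ^ i) = WithZero.exp ((B + multiple i Q.toPlace) Q.toPlace) ∧
      i + 1 ≤ finrank K (riemannRoch (B + multiple i Q.toPlace)) := by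
    intro i
    induction i with
    | zero =>
      have := hg.finite_riemannRoch Q B
      refine ⟨by simpa [multiple_zero] using hw, by simpa [multiple_zero] using hwv, ?_⟩
      rw [multiple_zero, add_zero]
      exact Submodule.one_le_finrank_iff.2 fun h => hw0 (by simpa [h] using hw)
    | succ i ih =>
      obtain ⟨h1, h2, h3⟩ := ih
      have hmem : w * f ^ (i + 1) ∈ riemannRoch (B + multiple (i + 1) Q.toPlace) := by
        have := mul_mem_riemannRoch h1 hf
        rwa [add_assoc, ← multiple_succ, mul_assoc, ← pow_succ] at this
      have hval : Q.val (w * f ^ (i + 1)) =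
          WithZero.exp ((B + multiple (i + 1) Q.toPlace) Q.toPlace) := by
        rw [pow_succ, ← mul_assoc, map_mul, h2, hfv, ← WithZero.exp_add, multiple_succ,
          ← add_assoc, Finsupp.add_apply _ (Finsupp.single _ _), Finsupp.single_eq_same]
      refine ⟨hmem, hval, ?_⟩
      have := hg.finite_riemannRoch Q (B + multiple (i + 1) Q.toPlace)
      have hnot := notMem_riemannRoch_sub_single hval
      have hlt : riemannRoch (B + multiple i Q.toPlace) <
          riemannRoch (B + multiple (i + 1) Q.toPlace) := by
        have heq : B + multiple i Q.toPlace =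
            B + multiple (i + 1) Q.toPlace - Finsupp.single Q.toPlace 1 := by
          rw [multiple_succ]; abel
        refine lt_of_le_not_ge (riemannRoch_mono (heq ▸ sub_single_le _ _)) fun h => ?_
        rw [← heq] at hnot
        exact hnot (h hmem)
      have := Submodule.finrank_lt_finrank_of_lt hlt
      omega
  have := (key d).2.2
  rw [hBdef, sub_add_cancel, ← hd] at this
  omega

/-- On an elliptic function field, `dim L(mQ) = m` for `m ≥ 1`. -/
theorem HasGenus.finrank_riemannRoch_multiple (hg : HasGenus K F 1) (hF : IsAlgFunctionField K F)
    (Q : RationalPlace K F) {m : ℕ} (hm : 1 ≤ m) :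
    finrank K (riemannRoch (multiple m Q.toPlace)) = m := by
  refine le_antisymm ?_ ?_
  · induction m, hm using Nat.le_induction with
    | base =>
      have := hg.finite_riemannRoch Q 0
      refine (Submodule.finrank_mono ?_).trans (hg.finrank_riemannRoch_zero_le hF Q)
      exact hg.riemannRoch_single_le hF Q
    | succ m _ ih =>
      have heq : multiple m Q.toPlace =
          multiple (m + 1) Q.toPlace - Finsupp.single Q.toPlace 1 := by
        rw [multiple_succ]; abel
      have := hg.finite_riemannRoch Q
        (multiple (m + 1) Q.toPlace - Finsupp.single Q.toPlace 1)
      have h := Q.finrank_riemannRoch_le (multiple (m + 1) Q.toPlace)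
      rw [← heq] at h
      omega
  · have := hg.deg_le_finrank (multiple m Q.toPlace)
    rw [deg_multiple] at this
    exact_mod_cast this

end GenusOne

/-! ### Bounds on the covering radius of a linear code. -/

section Codes

variable {K : Type*} [Field K] [DecidableEq K] {N : ℕ}

/-- The redundancy bound on the distance to a linear code. -/
theorem exists_hammingDist_le (C : Submodule K (Fin N → K)) (s : ℕ)
    (hs : N ≤ s + finrank K C) (v : Fin N → K) : ∃ c ∈ C, hammingDist v c ≤ s := by
  induction s generalizing C with
  | zero =>
    have hC : C = ⊤ := Submodule.eq_top_of_finrank_eq (le_antisymm (Submodule.finrank_le C) (by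
      simpa using hs))
    exact ⟨v, hC ▸ Submodule.mem_top, by simp⟩
  | succ s ih =>
    by_cases hC : C = ⊤
    · exact ⟨v, hC ▸ Submodule.mem_top, by simp⟩
    -- Adjoining a missing unit vector raises the dimension and costs at most one coordinate of
    -- distance.
    obtain ⟨i, hi⟩ : ∃ i, (Pi.single i 1 : Fin N → K) ∉ C := by
      by_contra! h
      refine hC (eq_top_iff.2 ?_)
      rw [← (Pi.basisFun K (Fin N)).span_eq, Submodule.span_le]
      rintro _ ⟨i, rfl⟩
      simpa using h i
    have hlt : C < C ⊔ Submodule.span K {Pi.single i 1} :=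
      left_lt_sup.2 fun h => hi (h (Submodule.mem_span_singleton_self _))
    have := Submodule.finrank_lt_finrank_of_lt hlt
    obtain ⟨c', hc', hd⟩ := ih (C ⊔ Submodule.span K {Pi.single i 1}) (by omega)
    obtain ⟨c, hc, e, he, rfl⟩ := Submodule.mem_sup.1 hc'
    obtain ⟨a, rfl⟩ := Submodule.mem_span_singleton.1 he
    refine ⟨c, hc, (hammingDist_triangle v _ c).trans (Nat.add_le_add hd ?_)⟩
    refine (Finset.card_le_card (t := {i}) fun j hj => ?_).trans (Finset.card_singleton i).le
    by_contra hji
    rw [Finset.mem_singleton] at hji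
    simp [Pi.single_eq_of_ne hji] at hj

theorem coveringRadius_le (C : Submodule K (Fin N → K)) (s : ℕ) (hs : N ≤ s + finrank K C) :
    coveringRadius C ≤ s :=
  Nat.sInf_le fun v => exists_hammingDist_le C s hs v

theorem le_coveringRadius {C : Submodule K (Fin N → K)} {s : ℕ} (v : Fin N → K)
    (h : ∀ c ∈ C, s ≤ hammingDist v c) : s ≤ coveringRadius C := by
  -- Nonemptiness matters here: the infimum of the empty set is `0`.
  refine le_csInf ⟨N, fun v => exists_hammingDist_le C N (Nat.le_add_right _ _) v⟩ ?_
  intro ρ hρ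
  obtain ⟨c, hc, hd⟩ := hρ v
  exact (h c hc).trans hd

theorem minDist_le_hammingNorm {C : Submodule K (Fin N → K)} {c : Fin N → K} (hc : c ∈ C)
    (h0 : c ≠ 0) : minDist C ≤ hammingNorm c :=
  Nat.sInf_le ⟨c, hc, h0, rfl⟩

theorem one_le_coveringRadius {C : Submodule K (Fin N → K)}
    (hC : finrank K C < N) : 1 ≤ coveringRadius C := by
  obtain ⟨v, hv⟩ : ∃ v, v ∉ C := by
    by_contra! h
    rw [(Submodule.eq_top_iff').2 h, finrank_top, Module.finrank_fin_fun] at hC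
    exact hC.false
  refine le_coveringRadius v fun c hc => ?_
  rw [Nat.one_le_iff_ne_zero, hammingDist_ne_zero]
  rintro rfl
  exact hv hc

end Codes

theorem hammingDist_comp_castSucc_le {K : Type*} [DecidableEq K] {N : ℕ} (v w : Fin (N + 1) → K) :
    hammingDist (v ∘ Fin.castSucc) (w ∘ Fin.castSucc) ≤ hammingDist v w := by
  rw [hammingDist, hammingDist, ← Finset.card_map Fin.castSuccEmb]
  refine Finset.card_le_card fun i hi => ?_
  obtain ⟨j, hj, rfl⟩ := Finset.mem_map.1 hi
  simpa using hj

/-! ### Evaluation codes and the extended code. -/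

section EllipticCodes

variable {K F : Type*} [Field K] [Field F] [Algebra K F] {n : ℕ}

/-- The divisor `P₁ + ⋯ + Pₙ`. -/
def sumDivisor (P : Fin n → RationalPlace K F) : Divisor K F :=
  ∑ i, Finsupp.single (P i).toPlace 1

theorem deg_sumDivisor (P : Fin n → RationalPlace K F) : (sumDivisor P).deg = n := by
  have h : ∀ s : Finset (Fin n),
      Divisor.deg (∑ i ∈ s, Finsupp.single (P i).toPlace 1) = s.card := fun s => by
    induction s using Finset.induction_on with
    | empty => simp [Divisor.deg_zero]
    | insert i s hi ih =>
      rw [Finset.sum_insert hi, Divisor.deg_add, ih, RationalPlace.deg_single,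
        Finset.card_insert_of_notMem hi]
      push_cast
      ring
  simpa [sumDivisor] using h Finset.univ

theorem mem_riemannRoch_sub_sumDivisor {P : Fin n → RationalPlace K F}
    (hP : Function.Injective P) {G : Divisor K F} (hG : ∀ i, G (P i).toPlace = 0)
    (g : riemannRoch G) (hg : evalMap P G hG g = 0) :
    (g : F) ∈ riemannRoch (G - sumDivisor P) := by
  have hsum : ∀ R : Place K F, sumDivisor P R = ∑ i, Finsupp.single (P i).toPlace (1 : ℤ) R :=
    fun R => Finsupp.finsetSum_apply _ _ _
  intro R
  rw [Finsupp.sub_apply, hsum]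
  by_cases hR : ∃ i, R = (P i).toPlace
  · obtain ⟨i, rfl⟩ := hR
    have hone : ∑ j, Finsupp.single (P j).toPlace (1 : ℤ) (P i).toPlace = 1 := by
      rw [Finset.sum_eq_single i, Finsupp.single_eq_same]
      · intro j _ hj
        exact Finsupp.single_eq_of_ne fun h =>
          hj (hP (RationalPlace.ext (congrArg Place.ring h.symm)))
      · simp
    rw [hone, hG]
    refine (P i).val_le_exp_sub_one ?_
    exact ((P i).eval_eq_zero_iff ⟨g, mem_ring_of_mem_riemannRoch (hG i) g.2⟩).1 (congrFun hg i)
  · push Not at hR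
    rw [Finset.sum_eq_zero fun i _ => Finsupp.single_eq_of_ne (hR i), sub_zero]
    exact g.2 R

/-- A function in the kernel lies in `L(G - D)`, a space of negative degree. -/
theorem HasGenus.evalMap_injective (hg : HasGenus K F 1) (hF : IsAlgFunctionField K F)
    {P : Fin n → RationalPlace K F} (hP : Function.Injective P) (Q : RationalPlace K F)
    {G : Divisor K F} (hG : ∀ i, G (P i).toPlace = 0) (hdeg : G.deg < n) :
    Function.Injective (evalMap P G hG) := by
  rw [injective_iff_map_eq_zero]
  intro g h
  have hmem := mem_riemannRoch_sub_sumDivisor hP hG g h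
  rw [hg.riemannRoch_eq_bot hF Q (by rw [Divisor.deg_sub, deg_sumDivisor]; omega)] at hmem
  exact Subtype.ext ((Submodule.mem_bot K).1 hmem)

variable {P : Fin n → RationalPlace K F} {Q : RationalPlace K F} (hQ : ∀ i, P i ≠ Q)
  {m r : ℕ} (f : Basis (Fin (r + 1)) K (riemannRoch (multiple m Q.toPlace)))

theorem extMatrix_comp_castSucc (i : Fin (r + 1)) :
    (extMatrix P Q hQ m f).row i ∘ Fin.castSucc =
      evalMap P (multiple m Q.toPlace) (multiple_apply_eq_zero m hQ) (f i) := by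
  ext j
  simp [extMatrix, Matrix.row]

/-- The rows are already independent after deletion of the last coordinate. -/
theorem finrank_codeEx
    (hinj : Function.Injective (evalMap P (multiple m Q.toPlace) (multiple_apply_eq_zero m hQ))) :
    finrank K (codeEx P Q hQ m f) = r + 1 := by
  have hli : LinearIndependent K (extMatrix P Q hQ m f).row := by
    refine LinearIndependent.of_comp (LinearMap.funLeft K K (Fin.castSucc : Fin n → _)) ?_
    have : (LinearMap.funLeft K K (Fin.castSucc : Fin n → _)) ∘ (extMatrix P Q hQ m f).row =
        evalMap P (multiple m Q.toPlace) (multiple_apply_eq_zero m hQ) ∘ f :=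
      funext fun i => extMatrix_comp_castSucc hQ f i
    rw [this]
    exact f.linearIndependent.map' _ (LinearMap.ker_eq_bot.2 hinj)
  rw [codeEx, finrank_span_eq_card hli, Fintype.card_fin]

theorem comp_castSucc_mem_codeL {c : Fin (n + 1) → K} (hc : c ∈ codeEx P Q hQ m f) :
    c ∘ Fin.castSucc ∈ codeL P Q hQ m := by
  have hle : codeEx P Q hQ m f ≤
      (codeL P Q hQ m).comap (LinearMap.funLeft K K (Fin.castSucc : Fin n → _)) := by
    refine Submodule.span_le.2 ?_
    rintro _ ⟨i, rfl⟩
    exact ⟨f i, (extMatrix_comp_castSucc hQ f i).symm⟩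
  exact hle hc

theorem multiple_le_succ (m : ℕ) (R : Place K F) : multiple m R ≤ multiple (m + 1) R :=
  Finsupp.single_le_single.2 (by push_cast; omega)

theorem HasGenus.le_coveringRadius_codeEx [DecidableEq K] (hg : HasGenus K F 1)
    (hF : IsAlgFunctionField K F) {k : ℕ} (hk : 1 ≤ k) (hkn : k + 1 < n)
    (hP : Function.Injective P)
    (f : Basis (Fin (r + 1)) K (riemannRoch (multiple k Q.toPlace)))
    (hMDS : IsMDS (codeL P Q hQ (k + 1))) :
    n - k ≤ coveringRadius (codeEx P Q hQ k f) := by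
  have hl := hg.finrank_riemannRoch_multiple hF Q hk
  have hl' := hg.finrank_riemannRoch_multiple hF Q (m := k + 1) (by omega)
  obtain ⟨h, hh, hh'⟩ : ∃ h ∈ riemannRoch (multiple (k + 1) Q.toPlace),
      h ∉ riemannRoch (multiple k Q.toPlace) := by
    by_contra! hle
    have := hg.finite_riemannRoch Q (multiple k Q.toPlace)
    have := Submodule.finrank_mono (show riemannRoch (multiple (k + 1) Q.toPlace) ≤ _ from hle)
    omega
  have hinj := hg.evalMap_injective hF hP Q (multiple_apply_eq_zero (k + 1) hQ) (by
    rw [deg_multiple]; exact_mod_cast hkn)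
  have hdim : finrank K (codeL P Q hQ (k + 1)) = k + 1 := by
    rw [codeL, LinearMap.finrank_range_of_inj hinj, hl']
  -- The last entry `0` is arbitrary, since only the first `n` coordinates are compared.
  refine le_coveringRadius (Fin.snoc (evalMap P _ (multiple_apply_eq_zero (k + 1) hQ) ⟨h, hh⟩) 0)
    fun c hc => ?_
  obtain ⟨g, hgc⟩ := comp_castSucc_mem_codeL hQ f hc
  let g' : riemannRoch (multiple (k + 1) Q.toPlace) :=
    ⟨g, riemannRoch_mono (multiple_le_succ k _) g.2⟩
  have hgc' : evalMap P _ (multiple_apply_eq_zero (k + 1) hQ) g' = c ∘ Fin.castSucc := hgc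
  refine le_trans ?_ (hammingDist_comp_castSucc_le _ _)
  have hsnoc : (Fin.snoc (evalMap P _ (multiple_apply_eq_zero (k + 1) hQ) ⟨h, hh⟩) 0 :
      Fin (n + 1) → K) ∘ Fin.castSucc =
      evalMap P _ (multiple_apply_eq_zero (k + 1) hQ) ⟨h, hh⟩ := by
    ext j
    simp
  rw [hsnoc, ← hgc', hammingDist_eq_hammingNorm, ← map_neg, ← map_add]
  have hmin := minDist_le_hammingNorm
    (show evalMap P _ (multiple_apply_eq_zero (k + 1) hQ) (-⟨h, hh⟩ + g') ∈
      codeL P Q hQ (k + 1) from ⟨_, rfl⟩) (by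
    rw [Ne, map_eq_zero_iff _ hinj, neg_add_eq_zero]
    intro heq
    have hhg : h = g := congrArg Subtype.val heq
    exact hh' (hhg ▸ g.2))
  have : minDist (codeL P Q hQ (k + 1)) + finrank K (codeL P Q hQ (k + 1)) = n + 1 := hMDS
  omega

end EllipticCodes

end AGCode

end

theorem mainTheorem11 {K F : Type*} [Field K] [Finite K] [DecidableEq K] [Field F] [Algebra K F]
    (hF : AGCode.IsAlgFunctionField K F) (hg : AGCode.HasGenus K F 1)
    {n k : ℕ} (hk : 2 ≤ k) (hkn : k < n)
    (P : Fin n → AGCode.RationalPlace K F) (hP : Function.Injective P)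
    (Pinf : AGCode.RationalPlace K F) (hPinf : ∀ i, P i ≠ Pinf)
    {r : ℕ}
    (f : Module.Basis (Fin (r + 1)) K (AGCode.riemannRoch (AGCode.multiple k Pinf.toPlace)))
    (hMDS : AGCode.IsMDS (AGCode.codeL P Pinf hPinf (k + 1))) :
    AGCode.coveringRadius (AGCode.codeEx P Pinf hPinf k f) = n - k ∨
      AGCode.coveringRadius (AGCode.codeEx P Pinf hPinf k f) = n - k + 1 := by
  have hr : r + 1 = k := by
    rw [← hg.finrank_riemannRoch_multiple hF Pinf (by omega : 1 ≤ k),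
      Module.finrank_eq_card_basis f, Fintype.card_fin]
  have hdim := AGCode.finrank_codeEx hPinf f (hg.evalMap_injective hF hP Pinf _ (by
    rw [AGCode.deg_multiple]; exact_mod_cast hkn))
  have hupper := AGCode.coveringRadius_le (AGCode.codeEx P Pinf hPinf k f) (n - k + 1) (by omega)
  have hlower : n - k ≤ AGCode.coveringRadius (AGCode.codeEx P Pinf hPinf k f) := by
    -- When `k + 1 = n`, evaluation on `L((k+1)P_∞)` need not be injective, but the bound is then
    -- `1` and holds for any proper code.
    rcases (Nat.succ_le_of_lt hkn).eq_or_lt with h | h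
    · have := AGCode.one_le_coveringRadius (C := AGCode.codeEx P Pinf hPinf k f) (by omega)
      omega
    · exact hg.le_coveringRadius_codeEx hPinf hF (by omega) h hP f hMDS
  omega
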